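/- Let $k$ be an infinite field and $H$ a Hopf algebra over $k$ with coproduct $\Delta(x)=x_1\otimes x_2$ (Sweedler notation) and counit $\varepsilon$. Let $\alpha:H\times H\to k$ be a normalized convolution-invertible two-cocycle, i.e. a convolution-invertible bilinear form with $$\alpha(x_1,y_1)\,\alpha(x_2y_2,z)=\alpha(y_1,z_1)\,\alpha(x,y_2z_2),\qquad \alpha(x,1)=\alpha(1,x)=\varepsilon(x)\qquad(x,y,z\in H),$$ and let $\alpha^{-1}$ be its convolution inverse. The twisted algebra ${}^{\alpha}H$ is a copy $\{u_x : x\in H\}$ of the vector space $H$ with product $u_xu_y=\alpha(x_1,y_1)\,u_{x_2y_2}$ and unit $u_1$; it is a right $H$-comodule algebra with coaction $u_x\mapsto u_{x_1}\otimes x_2$. Assume that $\alpha$ is non-degenerate, i.e. that the center of ${}^{\alpha}H$ is one-dimensional over $k$. Let $T(X_H)$ be the tensor algebra on a copy $\{X_x : x\in H\}$ of $H$, an $H$-comodule algebra with coaction $X_x\mapsto X_{x_1}\otimes x_2$. Let $I_H^{\alpha}\subset T(X_H)$ be the ideal of elements killed by every $H$-comodule algebra map $T(X_H)\to{}^{\alpha}H$,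 let $\mathcal U_H^{\alpha}=T(X_H)/I_H^{\alpha}$, and let $\mathcal Z_H^{\alpha}$ be the center of $\mathcal U_H^{\alpha}$. Let $S(t_H)$ be the symmetric algebra on a copy $\{t_x : x\in H\}$ of $H$, with field of fractions $\operatorname{Frac}S(t_H)$, and let $\mu_\alpha:T(X_H)\to S(t_H)\otimes{}^{\alpha}H$ be the algebra map with $\mu_\alpha(X_x)=t_{x_1}\otimes u_{x_2}$. Then: 1. The linear map $x\mapsto t_x$ from $H$ to $\operatorname{Frac}S(t_H)$ has a (unique) convolution inverse $x\mapsto t^{-1}_x$, i.e. $t_{x_1}t^{-1}_{x_2}=t^{-1}_{x_1}t_{x_2}=\varepsilon(x)1$, and $\mu_\alpha$ induces an injective algebra map $\overline{\mu}_\alpha:\mathcal U_H^{\alpha}\hookrightarrow S(t_H)\otimes{}^{\alpha}H$. 2. Let the generic base algebra $\mathcal B_H^{\alpha}$ be the $k$-subalgebra of $\operatorname{Frac}S(t_H)$ generated by all the elements $$\sigma(x,y)=t_{x_1}t_{y_1}\,\alpha(x_2,y_2)\,t^{-1}_{x_3y_3},\qquad \sigma^{-1}(x,y)=t_{x_1y_1}\,\alpha^{-1}(x_2,y_2)\,t^{-1}_{x_3}t^{-1}_{y_3}\qquad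 (x,y\in H).$$ Viewing $S(t_H)\otimes{}^{\alpha}H$ inside $\operatorname{Frac}S(t_H)\otimes{}^{\alpha}H$, the map $\overline{\mu}_\alpha$ sends $\mathcal Z_H^{\alpha}$ into $\mathcal B_H^{\alpha}\otimes u_1$. 3. Hence there is an injective algebra map $\iota:\mathcal Z_H^{\alpha}\hookrightarrow\mathcal B_H^{\alpha}$ with $\overline{\mu}_\alpha(z)=\iota(z)\otimes u_1$ for all $z\in\mathcal Z_H^{\alpha}$. 4. $\mathcal Z_H^{\alpha}$ is a domain of Krull dimension at most $\dim_k H$ (no condition if $\dim_k H=\infty$). -/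

import Mathlib

open scoped TensorProduct
open Coalgebra

noncomputable section

namespace GenericHopf

universe u v w

/-! ### Comodule algebras and their identities -/

/-- A right `H`-comodule algebra: an algebra `A` with a coassociative and counital coaction
`δ : A → A ⊗ H` which is an algebra map. -/
class ComoduleAlgebra (k : Type u) (H : Type v) (A : Type w) [Field k] [Ring H] [Bialgebra k H]
    [Ring A] [Algebra k A] where
  coaction : A →ₐ[k] A ⊗[k] H
  coassoc : ∀ a : A, TensorProduct.assoc k A H H (coaction.toLinearMap.rTensor H (coaction a)) =
    (comul : H →ₗ[k] H ⊗[k] H).lTensor A (coaction a)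
  counit_coaction : ∀ a : A, (counit : H →ₗ[k] k).lTensor A (coaction a) = a ⊗ₜ[k] 1

/-- An algebra map `f : A → B` is an `H`-comodule algebra map if `δ_B ∘ f = (f ⊗ id) ∘ δ_A`. -/
def IsComoduleAlgHom {k : Type u} (H : Type v) {A B : Type*} [Field k] [Ring H] [Bialgebra k H]
    [Ring A] [Algebra k A] [ComoduleAlgebra k H A] [Ring B] [Algebra k B] [ComoduleAlgebra k H B]
    (f : A →ₐ[k] B) : Prop :=
  ∀ a : A, ComoduleAlgebra.coaction (k := k) (H := H) (f a) =
    f.toLinearMap.rTensor H (ComoduleAlgebra.coaction a)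

section Auxiliary

variable {k : Type u} {H : Type v} {M : Type w} [Field k] [Ring H] [Bialgebra k H]
  [AddCommGroup M] [Module k M]

theorem coassoc_aux (f : H →ₗ[k] M) (δ : M →ₗ[k] M ⊗[k] H)
    (h : ∀ x, δ (f x) = f.rTensor H (comul (R := k) x)) (x : H) :
    TensorProduct.assoc k M H H (δ.rTensor H (δ (f x))) =
      (comul : H →ₗ[k] H ⊗[k] H).lTensor M (δ (f x)) := by
  have e : ∀ s : H ⊗[k] H, TensorProduct.assoc k M H H (δ.rTensor H (f.rTensor H s)) =
      f.rTensor (H ⊗[k] H) (TensorProduct.assoc k H H H ((comul (R := k)).rTensor H s)) := by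
    intro s
    induction s using TensorProduct.induction_on with
    | zero => simp
    | add x y hx hy => simp only [map_add, hx, hy]
    | tmul a b =>
      simp only [LinearMap.rTensor_tmul, h]
      generalize comul (R := k) a = t
      induction t using TensorProduct.induction_on with
      | zero => simp
      | add x y hx hy => simp only [TensorProduct.add_tmul, map_add, hx, hy]
      | tmul c d => simp
  rw [h, e, Coalgebra.coassoc_apply]
  change (f.rTensor (H ⊗[k] H) ∘ₗ comul.lTensor H) (comul x) =
    (comul.lTensor M ∘ₗ f.rTensor H) (comul x)
  rw [LinearMap.rTensor_comp_lTensor, LinearMap.lTensor_comp_rTensor]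

theorem counit_aux (f : H →ₗ[k] M) (δ : M →ₗ[k] M ⊗[k] H)
    (h : ∀ x, δ (f x) = f.rTensor H (comul (R := k) x)) (x : H) :
    (counit : H →ₗ[k] k).lTensor M (δ (f x)) = f x ⊗ₜ[k] 1 := by
  rw [h, ← LinearMap.comp_apply, LinearMap.lTensor_comp_rTensor, ← LinearMap.rTensor_comp_lTensor,
    LinearMap.comp_apply, Coalgebra.lTensor_counit_comul, LinearMap.rTensor_tmul]

end Auxiliary

section TensorAlgebra

variable (k : Type u) (H : Type v) [Field k] [Ring H] [Bialgebra k H]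

/-- The coaction of the tensor algebra `T(X_H)`: `X_x ↦ X_{x₁} ⊗ x₂`. -/
def tensorCoaction : TensorAlgebra k H →ₐ[k] TensorAlgebra k H ⊗[k] H :=
  TensorAlgebra.lift k ((TensorAlgebra.ι k).rTensor H ∘ₗ comul)

theorem tensorCoaction_ι (x : H) : tensorCoaction k H (TensorAlgebra.ι k x) =
    (TensorAlgebra.ι k).rTensor H (comul (R := k) x) := by
  simp [tensorCoaction]

/-- The tensor algebra `T(X_H)` is an `H`-comodule algebra. -/
instance : ComoduleAlgebra k H (TensorAlgebra k H) where
  coaction := tensorCoaction k H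
  coassoc a := by
    have h : ((Algebra.TensorProduct.assoc k k k (TensorAlgebra k H) H H).toAlgHom.comp
        (Algebra.TensorProduct.map (tensorCoaction k H) (AlgHom.id k H))).comp
          (tensorCoaction k H) =
        (Algebra.TensorProduct.map (AlgHom.id k (TensorAlgebra k H))
          (Bialgebra.comulAlgHom k H)).comp (tensorCoaction k H) := by
      apply TensorAlgebra.hom_ext
      ext x
      exact coassoc_aux (TensorAlgebra.ι k) (tensorCoaction k H).toLinearMap
        (tensorCoaction_ι k H) x
    exact DFunLike.congr_fun h a
  counit_coaction a := by
    have h : (Algebra.TensorProduct.map (AlgHom.id k (TensorAlgebra k H))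
          (Bialgebra.counitAlgHom k H)).comp (tensorCoaction k H) =
        Algebra.TensorProduct.includeLeft := by
      apply TensorAlgebra.hom_ext
      ext x
      exact counit_aux (TensorAlgebra.ι k) (tensorCoaction k H).toLinearMap
        (tensorCoaction_ι k H) x
    exact DFunLike.congr_fun h a

end TensorAlgebra

section Identities

variable (k : Type u) (H : Type v) (A : Type w) [Field k] [Ring H] [Bialgebra k H]
  [Ring A] [Algebra k A] [ComoduleAlgebra k H A]

/-- The ideal `I_H(A)` of `H`-identities for `A`: the elements of `T(X_H)` killed by all
`H`-comodule algebra maps `T(X_H) → A`. -/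
def identityIdeal : Ideal (TensorAlgebra k H) :=
  ⨅ f : {f : TensorAlgebra k H →ₐ[k] A // IsComoduleAlgHom H f}, RingHom.ker f.1

theorem mem_identityIdeal (P : TensorAlgebra k H) : P ∈ identityIdeal k H A ↔
    ∀ f : TensorAlgebra k H →ₐ[k] A, IsComoduleAlgHom H f → f P = 0 := by
  simp [identityIdeal, RingHom.mem_ker]

instance : (identityIdeal k H A).IsTwoSided where
  mul_mem_of_left b ha := by
    rw [mem_identityIdeal] at ha ⊢
    intro f hf
    rw [map_mul, ha f hf, zero_mul]

/-- The universal `H`-comodule algebra `U_H(A) = T(X_H) / I_H(A)`. -/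
abbrev UniversalAlgebra : Type _ := TensorAlgebra k H ⧸ identityIdeal k H A

end Identities

/-! ### Two-cocycles and twisted algebras -/

section Cocycle

variable (k : Type u) (H : Type v) [Field k] [Ring H] [Bialgebra k H]

/-- A normalized convolution-invertible two-cocycle `α : H × H → k`, where `ℛ k x` is a
decomposition `Δ(x) = ∑ᵢ x₁ ⊗ x₂`:
`α(x₁, y₁) α(x₂ y₂, z) = α(y₁, z₁) α(x, y₂ z₂)` and `α(x, 1) = α(1, x) = ε(x)`. -/
structure TwoCocycle where
  form : LinearMap.BilinForm k H
  cocycle : ∀ x y z : H,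
    ∑ i ∈ (ℛ k x).index, ∑ j ∈ (ℛ k y).index,
      form ((ℛ k x).left i) ((ℛ k y).left j) * form ((ℛ k x).right i * (ℛ k y).right j) z =
    ∑ i ∈ (ℛ k y).index, ∑ j ∈ (ℛ k z).index,
      form ((ℛ k y).left i) ((ℛ k z).left j) * form x ((ℛ k y).right i * (ℛ k z).right j)
  isUnit : IsUnit (WithConv.toConv (TensorProduct.lift form))
  form_one_right : ∀ x : H, form x 1 = counit x
  form_one_left : ∀ x : H, form 1 x = counit x

end Cocycle

section Twisting

variable {k : Type u} {D E : Type*} [Field k] [AddCommMonoid D] [Module k D] [Coalgebra k D]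
  [AddCommMonoid E] [Module k E] [Coalgebra k E]

/-- For a linear form `f` on a coalgebra, the map `d ↦ f(d₁) d₂`. -/
def twist (f : D →ₗ[k] k) : D →ₗ[k] D :=
  (TensorProduct.lid k D).toLinearMap ∘ₗ f.rTensor D ∘ₗ comul

theorem twist_repr (f : D →ₗ[k] k) {ι : Type*} (d : D) (r : Coalgebra.Repr k d ι) :
    twist f d = ∑ i ∈ r.index, f (r.left i) • r.right i := by
  simp [twist, ← r.eq]

theorem twist_counit : twist (counit : D →ₗ[k] k) = LinearMap.id := by
  ext d
  simp [twist]

theorem comul_twist (f : D →ₗ[k] k) (d : D) :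
    comul (R := k) (twist f d) = (twist f).rTensor D (comul d) := by
  have key : ∀ t : D ⊗[k] D, comul (R := k) (TensorProduct.lid k D (f.rTensor D t)) =
      ((TensorProduct.lid k D).toLinearMap ∘ₗ f.rTensor D).rTensor D
        ((TensorProduct.assoc k D D D).symm ((comul (R := k)).lTensor D t)) := by
    intro t
    induction t using TensorProduct.induction_on with
    | zero => simp
    | add x y hx hy => simp only [map_add, hx, hy]
    | tmul a b =>
      simp only [LinearMap.rTensor_tmul, TensorProduct.lid_tmul, map_smul, LinearMap.lTensor_tmul]
      generalize comul (R := k) b = s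
      induction s using TensorProduct.induction_on with
      | zero => simp
      | add x y hx hy => simp only [TensorProduct.tmul_add, smul_add, map_add, hx, hy]
      | tmul c e => simp [TensorProduct.smul_tmul']
  calc comul (R := k) (twist f d) = _ := key (comul d)
    _ = _ := by
      rw [Coalgebra.coassoc_symm_apply, ← LinearMap.rTensor_comp_apply]
      rfl

theorem twist_twist (f g : D →ₗ[k] k) (d : D) : twist g (twist f d) = twist (g ∘ₗ twist f) d := by
  have h := congrArg (fun t => TensorProduct.lid k D (g.rTensor D t)) (comul_twist f d)
  simp only [← LinearMap.rTensor_comp_apply] at h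
  exact h

theorem twist_coalgHom (f : E →ₗ[k] k) (h : D →ₗc[k] E) (d : D) :
    h (twist (f ∘ₗ h.toLinearMap) d) = twist f (h d) := by
  rw [twist_repr _ d (ℛ k d), twist_repr _ _ ((ℛ k d).induced h)]
  simp

end Twisting

theorem twist_tmul {k : Type*} [Field k] {D E : Type*} [Ring D] [Bialgebra k D] [Ring E] [Bialgebra k E]
    (f : D →ₗ[k] k) (d : D) (e : E) : twist f d ⊗ₜ[k] e =
    twist (LinearMap.mul' k k ∘ₗ TensorProduct.map f counit) (d ⊗ₜ[k] e) := by
  rw [twist_repr _ _ (ℛ k d), twist_repr _ _ ((ℛ k d).tmul (ℛ k e))]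
  conv_lhs => rw [← Coalgebra.sum_counit_smul (ℛ k e)]
  simp [TensorProduct.sum_tmul, TensorProduct.tmul_sum, Finset.sum_product, mul_smul,
    TensorProduct.smul_tmul', Finset.smul_sum]
  rw [Finset.sum_comm]
  refine Finset.sum_congr rfl fun i _ => Finset.sum_congr rfl fun j _ => ?_
  rw [smul_comm]

theorem tmul_twist {k : Type*} [Field k] {D E : Type*} [Ring D] [Bialgebra k D] [Ring E] [Bialgebra k E]
    (f : E →ₗ[k] k) (d : D) (e : E) : d ⊗ₜ[k] twist f e =
    twist (LinearMap.mul' k k ∘ₗ TensorProduct.map counit f) (d ⊗ₜ[k] e) := by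
  rw [twist_repr _ _ (ℛ k e), twist_repr _ _ ((ℛ k d).tmul (ℛ k e))]
  conv_lhs => rw [← Coalgebra.sum_counit_smul (ℛ k d)]
  simp [TensorProduct.sum_tmul, TensorProduct.tmul_sum, Finset.sum_product, mul_smul,
    TensorProduct.smul_tmul', Finset.smul_sum]
  rw [Finset.sum_comm]
  refine Finset.sum_congr rfl fun i _ => Finset.sum_congr rfl fun j _ => ?_
  rw [smul_comm]

namespace TwoCocycle

variable {k : Type u} {H : Type v} [Field k] [Ring H] [Bialgebra k H] (α : TwoCocycle k H)

/-- The linear form on `H ⊗ H` given by `α`. -/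
def lin : H ⊗[k] H →ₗ[k] k := TensorProduct.lift α.form

/-- The convolution inverse `α⁻¹`, as a linear form on `H ⊗ H`. -/
def inv : H ⊗[k] H →ₗ[k] k :=
  ((α.isUnit.unit⁻¹ : (WithConv (H ⊗[k] H →ₗ[k] k))ˣ) : WithConv (H ⊗[k] H →ₗ[k] k)).ofConv

/-- The twisted product `x ⊗ y ↦ α(x₁, y₁) x₂ y₂`. -/
def mulLin : H ⊗[k] H →ₗ[k] H := LinearMap.mul' k H ∘ₗ twist α.lin

theorem mulLin_assoc (x y z : H) :
    α.mulLin (α.mulLin (x ⊗ₜ y) ⊗ₜ z) = α.mulLin (x ⊗ₜ α.mulLin (y ⊗ₜ z)) := by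
  let m : H ⊗[k] H →ₗc[k] H := Bialgebra.mulCoalgHom k H
  let L : (H ⊗[k] H) ⊗[k] H →ₗc[k] H ⊗[k] H :=
    Coalgebra.TensorProduct.map m (CoalgHom.id k H)
  let R : H ⊗[k] (H ⊗[k] H) →ₗc[k] H ⊗[k] H :=
    Coalgebra.TensorProduct.map (CoalgHom.id k H) m
  let a : (H ⊗[k] H) ⊗[k] H →ₗc[k] H ⊗[k] (H ⊗[k] H) :=
    (Coalgebra.TensorProduct.assoc k k H H H : _ →ₗc[k] _)
  let f : (H ⊗[k] H) ⊗[k] H →ₗ[k] k := LinearMap.mul' k k ∘ₗ TensorProduct.map α.lin counit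
  let g : H ⊗[k] (H ⊗[k] H) →ₗ[k] k := LinearMap.mul' k k ∘ₗ TensorProduct.map counit α.lin
  have h1 : ∀ x y z : H, α.mulLin (α.mulLin (x ⊗ₜ y) ⊗ₜ z) =
      m (L (twist ((α.lin ∘ₗ L.toLinearMap) ∘ₗ twist f) ((x ⊗ₜ y) ⊗ₜ z))) := by
    intro x y z
    rw [← twist_twist, twist_coalgHom, ← twist_tmul]
    rfl
  have h2 : ∀ x y z : H, α.mulLin (x ⊗ₜ α.mulLin (y ⊗ₜ z)) =
      m (R (twist ((α.lin ∘ₗ R.toLinearMap) ∘ₗ twist g) (x ⊗ₜ (y ⊗ₜ z)))) := by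
    intro x y z
    rw [← twist_twist, twist_coalgHom, ← tmul_twist]
    rfl
  have h3 : (α.lin ∘ₗ L.toLinearMap) ∘ₗ twist f =
      ((α.lin ∘ₗ R.toLinearMap) ∘ₗ twist g) ∘ₗ a.toLinearMap := by
    ext x y z
    change α.lin (L (twist f ((x ⊗ₜ y) ⊗ₜ z))) = α.lin (R (twist g (x ⊗ₜ (y ⊗ₜ z))))
    rw [← twist_tmul, ← tmul_twist, twist_repr _ _ ((ℛ k x).tmul (ℛ k y)),
      twist_repr _ _ ((ℛ k y).tmul (ℛ k z))]
    have h := α.cocycle x y z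
    simpa [lin, L, R, m, TensorProduct.sum_tmul, TensorProduct.tmul_sum, Finset.sum_product,
      TensorProduct.smul_tmul'] using h
  have h4 : ∀ w, m (R (a w)) = m (L w) := by
    intro w
    induction w using TensorProduct.induction_on with
    | zero => simp
    | add x y hx hy => simp only [map_add, hx, hy]
    | tmul v z =>
      induction v using TensorProduct.induction_on with
      | zero => simp
      | add x y hx hy => simp only [TensorProduct.add_tmul, map_add, hx, hy]
      | tmul x y => exact (mul_assoc x y z).symm
  rw [h1, h2, h3, ← h4, twist_coalgHom]
  rfl

/-- The decomposition `Δ(1) = 1 ⊗ 1`. -/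
def reprOne (k : Type u) (H : Type v) [Field k] [Ring H] [Bialgebra k H] :
    Coalgebra.Repr k (1 : H) Unit where
  index := {()}
  left _ := 1
  right _ := 1
  eq := by simp [Algebra.TensorProduct.one_def]

theorem mulLin_one_left (x : H) : α.mulLin (1 ⊗ₜ x) = x := by
  have h : twist α.lin (1 ⊗ₜ x) = (1 : H) ⊗ₜ[k] x := by
    rw [twist_repr _ _ ((reprOne k H).tmul (ℛ k x))]
    simp [lin, reprOne, α.form_one_left, ← TensorProduct.tmul_smul,
      ← TensorProduct.tmul_sum, Coalgebra.sum_counit_smul]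
  simp [mulLin, h]

theorem mulLin_one_right (x : H) : α.mulLin (x ⊗ₜ 1) = x := by
  have h : twist α.lin (x ⊗ₜ 1) = x ⊗ₜ[k] (1 : H) := by
    rw [twist_repr _ _ ((ℛ k x).tmul (reprOne k H))]
    simp [lin, reprOne, α.form_one_right, TensorProduct.smul_tmul',
      ← TensorProduct.sum_tmul, Coalgebra.sum_counit_smul]
  simp [mulLin, h]

theorem comul_mulLin (x y : H) : comul (R := k) (α.mulLin (x ⊗ₜ y)) =
    TensorProduct.map α.mulLin (LinearMap.mul' k H) (comul (R := k) (x ⊗ₜ[k] y)) := by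
  have h := CoalgHomClass.map_comp_comul_apply (Bialgebra.mulCoalgHom k H)
    (twist α.lin (x ⊗ₜ y))
  rw [comul_twist] at h
  refine h.symm.trans ?_
  rw [← LinearMap.comp_apply, LinearMap.map_comp_rTensor]
  rfl

/-- The twisted algebra `ᵅH`: a copy of `H` with `u_x u_y = α(x₁, y₁) u_{x₂ y₂}`. -/
def TwistedAlgebra (_ : TwoCocycle k H) : Type v := H

instance : AddCommGroup α.TwistedAlgebra := inferInstanceAs (AddCommGroup H)

instance : Module k α.TwistedAlgebra := inferInstanceAs (Module k H)

/-- The identity map `x ↦ u_x` from `H` to `ᵅH`. -/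
def u : H ≃ₗ[k] α.TwistedAlgebra := LinearEquiv.refl k H

instance : Ring α.TwistedAlgebra where
  __ := (inferInstance : AddCommGroup α.TwistedAlgebra)
  mul a b := α.u (α.mulLin (α.u.symm a ⊗ₜ α.u.symm b))
  one := α.u 1
  mul_assoc a b c := α.mulLin_assoc a b c
  one_mul a := α.mulLin_one_left a
  mul_one a := α.mulLin_one_right a
  left_distrib a b c := by
    change α.u (α.mulLin (α.u.symm a ⊗ₜ α.u.symm (b + c))) = _
    rw [map_add, TensorProduct.tmul_add, map_add, map_add]
    rfl
  right_distrib a b c := by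
    change α.u (α.mulLin (α.u.symm (a + b) ⊗ₜ α.u.symm c)) = _
    rw [map_add, TensorProduct.add_tmul, map_add, map_add]
    rfl
  zero_mul a := by
    change α.u (α.mulLin (α.u.symm 0 ⊗ₜ α.u.symm a)) = _
    rw [map_zero, TensorProduct.zero_tmul, map_zero, map_zero]
  mul_zero a := by
    change α.u (α.mulLin (α.u.symm a ⊗ₜ α.u.symm 0)) = _
    rw [map_zero, TensorProduct.tmul_zero, map_zero, map_zero]

theorem u_mul (x y : H) : α.u x * α.u y = α.u (α.mulLin (x ⊗ₜ y)) := rfl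

theorem one_eq_u : (1 : α.TwistedAlgebra) = α.u 1 := rfl

instance : Algebra k α.TwistedAlgebra :=
  Algebra.ofModule
    (fun r a b => by
      obtain ⟨x, rfl⟩ := α.u.surjective a
      obtain ⟨y, rfl⟩ := α.u.surjective b
      rw [← map_smul, u_mul, u_mul, ← TensorProduct.smul_tmul', map_smul, map_smul])
    (fun r a b => by
      obtain ⟨x, rfl⟩ := α.u.surjective a
      obtain ⟨y, rfl⟩ := α.u.surjective b
      rw [← map_smul, u_mul, u_mul, TensorProduct.tmul_smul, map_smul, map_smul])

/-- The coaction `u_x ↦ u_{x₁} ⊗ x₂` of `ᵅH`, as a linear map. -/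
def coactionLin : α.TwistedAlgebra →ₗ[k] α.TwistedAlgebra ⊗[k] H :=
  α.u.toLinearMap.rTensor H ∘ₗ comul ∘ₗ α.u.symm.toLinearMap

theorem coactionLin_u (x : H) :
    α.coactionLin (α.u x) = α.u.toLinearMap.rTensor H (comul (R := k) x) := by
  simp [coactionLin]

/-- The twisted algebra `ᵅH` is an `H`-comodule algebra. -/
instance : ComoduleAlgebra k H α.TwistedAlgebra where
  coaction := AlgHom.ofLinearMap α.coactionLin
    (by
      rw [one_eq_u, coactionLin_u, Bialgebra.comul_one, Algebra.TensorProduct.one_def]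
      rfl)
    (by
      intro a b
      obtain ⟨x, rfl⟩ := α.u.surjective a
      obtain ⟨y, rfl⟩ := α.u.surjective b
      rw [u_mul, coactionLin_u, coactionLin_u, coactionLin_u, comul_mulLin,
        ← ((ℛ k x).tmul (ℛ k y)).eq, ← (ℛ k x).eq, ← (ℛ k y).eq]
      simp [Finset.sum_product, Finset.sum_mul_sum, u_mul])
  coassoc a := by
    obtain ⟨x, rfl⟩ := α.u.surjective a
    exact coassoc_aux α.u.toLinearMap α.coactionLin α.coactionLin_u x
  counit_coaction a := by
    obtain ⟨x, rfl⟩ := α.u.surjective a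
    exact counit_aux α.u.toLinearMap α.coactionLin α.coactionLin_u x

/-- `α` is non-degenerate if the center of `ᵅH` is one-dimensional. -/
def IsNondegenerate : Prop := Module.finrank k (Subalgebra.center k α.TwistedAlgebra) = 1

/-- The universal comodule algebra map `μ_α : T(X_H) → S(t_H) ⊗ ᵅH`,
`X_x ↦ t_{x₁} ⊗ u_{x₂}`. -/
def universalMap : TensorAlgebra k H →ₐ[k] SymmetricAlgebra k H ⊗[k] α.TwistedAlgebra :=
  TensorAlgebra.lift k (TensorProduct.map (SymmetricAlgebra.ι k H) α.u.toLinearMap ∘ₗ comul)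

end TwoCocycle

/-! ### The generic base algebra -/

section GenericBase

variable (k : Type u) (H : Type v) [Field k] [Ring H] [Bialgebra k H]

/-- The field of fractions `Frac S(t_H)`. -/
abbrev FracS : Type _ := FractionRing (SymmetricAlgebra k H)

/-- The inclusion `S(t_H) → Frac S(t_H)`. -/
def toFracS : SymmetricAlgebra k H →ₐ[k] FracS k H :=
  IsScalarTower.toAlgHom k (SymmetricAlgebra k H) (FracS k H)

/-- The linear map `x ↦ t_x` from `H` to `Frac S(t_H)`. -/
def genT : H →ₗ[k] FracS k H := (toFracS k H).toLinearMap ∘ₗ SymmetricAlgebra.ι k H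

/-- The linear map `x ↦ t⁻¹_x`: the inverse of `x ↦ t_x` for convolution, that is,
`t_{x₁} t⁻¹_{x₂} = t⁻¹_{x₁} t_{x₂} = ε(x) 1`. -/
def genTInv : H →ₗ[k] FracS k H := (Ring.inverse (WithConv.toConv (genT k H))).ofConv

/-- For linear maps `f, g : H → Frac S(t_H)`, the map `x ⊗ y ↦ f(x) g(y)`. -/
def outer (f g : H →ₗ[k] FracS k H) : H ⊗[k] H →ₗ[k] FracS k H :=
  LinearMap.mul' k (FracS k H) ∘ₗ TensorProduct.map f g

variable {k H} (α : TwoCocycle k H)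

open WithConv in
/-- `σ(x, y) = t_{x₁} t_{y₁} α(x₂, y₂) t⁻¹_{x₃ y₃}`, a product of three maps for the convolution
of linear maps `H ⊗ H → Frac S(t_H)`. -/
def TwoCocycle.sigma : H ⊗[k] H →ₗ[k] FracS k H :=
  (toConv (outer k H (genT k H) (genT k H)) *
    toConv (Algebra.linearMap k (FracS k H) ∘ₗ α.lin) *
    toConv (genTInv k H ∘ₗ LinearMap.mul' k H)).ofConv

open WithConv in
/-- `σ⁻¹(x, y) = t_{x₁ y₁} α⁻¹(x₂, y₂) t⁻¹_{x₃} t⁻¹_{y₃}`. -/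
def TwoCocycle.sigmaInv : H ⊗[k] H →ₗ[k] FracS k H :=
  (toConv (genT k H ∘ₗ LinearMap.mul' k H) *
    toConv (Algebra.linearMap k (FracS k H) ∘ₗ α.inv) *
    toConv (outer k H (genTInv k H) (genTInv k H))).ofConv

/-- The generic base algebra `B_H^α`: the subalgebra of `Frac S(t_H)` generated by all
`σ(x, y)` and `σ⁻¹(x, y)`. -/
def TwoCocycle.genericBase : Subalgebra k (FracS k H) :=
  Algebra.adjoin k ({s | ∃ x y : H, s = α.sigma (x ⊗ₜ y)} ∪ {s | ∃ x y : H, s = α.sigmaInv (x ⊗ₜ y)})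

/-- The inclusion `S(t_H) ⊗ ᵅH → Frac S(t_H) ⊗ ᵅH`. -/
def TwoCocycle.inclFrac :
    SymmetricAlgebra k H ⊗[k] α.TwistedAlgebra →ₐ[k] FracS k H ⊗[k] α.TwistedAlgebra :=
  Algebra.TensorProduct.map (toFracS k H) (AlgHom.id k α.TwistedAlgebra)

end GenericBase

end GenericHopf

end

noncomputable section

/-! ### Krull dimension and algebraic independence -/

section KrullDimension

open Cardinal

/-! Write `K` for `Frac S(t_H)`. A comodule algebra map from `T(X_H)` to `ᵅH` is determined by the
linear form `l` that it induces on `H` through the counit: it sends `X_x` to `l(x₁) u_{x₂}`, so it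
is `μ_α` followed by the specialization `t_x ↦ l(x)` (`eq_specialize`). Over an infinite field an
element of `S(t_H)` that vanishes under all specializations is zero; hence `I_H^α = ker μ_α`, and
`μ_α` induces an injection.

The map `x ↦ t_x` is convolution invertible because `a ⊗ x ↦ a t_{x₁} ⊗ x₂` is bijective on `K ⊗ H`:
on each finite-dimensional subcomodule it is a matrix over `S(t_H)`, whose determinant becomes `1`
under `t_x ↦ ε(x)` (`isUnit_toConv_of_specialization`).

Put `v_x = t_{x₁} ⊗ u_{x₂}`. By this invertibility the `v_x` span `K ⊗ ᵅH` over `K`, so the image of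
a central element commutes with all of `1 ⊗ ᵅH`; by non-degeneracy it has the form `b ⊗ 1`. On the
other hand `v_x v_y = σ(x₁, y₁) v_{x₂ y₂}` (`genericElement_mul`), so the image of `μ_α` lies in the
`B_H^α`-span of the `v_x`. The contraction `a ⊗ u_x ↦ a t⁻¹_x` sends `v_x` to `ε(x)`, hence this
span into `B_H^α`, and it sends `b ⊗ 1` to `b t⁻¹_1`. As `t_1 = σ(1, 1)`, it follows that `b` is in
`B_H^α`.

The center thus embeds in the field `K`. It is a domain, and its Krull dimension is at most its
transcendence degree, which is at most that of `K`, namely `dim H`. -/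

theorem AlgebraicIndependent.option_of_mem_ker {k A B ι : Type*} [CommRing k] [CommRing A]
    [IsDomain A] [CommRing B] [Algebra k A] [Algebra k B] (f : A →ₐ[k] B) {y : ι → A} {x : A}
    (hy : AlgebraicIndependent k (f ∘ y)) (hx0 : x ≠ 0) (hx : f x = 0) :
    AlgebraicIndependent k (fun o : Option ι => o.elim x y) := by
  rw [(hy.of_comp f).option_iff_transcendental]
  intro hal
  -- Since `x` is nonzero in a domain, powers of `X` can be divided out of a relation for `x`, so
  -- the constant term may be taken nonzero. Applying `f` kills `x` and leaves only that constant
  -- term, a polynomial in `y`.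
  obtain ⟨q, hq0, hq⟩ :=
    hal.exists_nonzero_coeff_and_aeval_eq_zero (mem_nonZeroDivisors_of_ne_zero hx0)
  have hc : f (q.coeff 0 : A) = 0 := by
    have h := congrArg f hq
    rw [← Polynomial.divX_mul_X_add q] at h
    simpa [hx] using h
  have hmem : (q.coeff 0 : A) ∈ (MvPolynomial.aeval (R := k) y).range := by
    rw [← Algebra.adjoin_range_eq_range_aeval]
    exact (q.coeff 0).2
  obtain ⟨p, hp⟩ := hmem
  have hp' : MvPolynomial.aeval (f ∘ y) p = 0 := by
    have e : MvPolynomial.aeval (R := k) (f ∘ y) = f.comp (MvPolynomial.aeval y) := by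
      ext; simp
    rw [e, AlgHom.comp_apply, ← hc, ← hp]
    rfl
  have hp0 : p = 0 := (injective_iff_map_eq_zero _).mp hy p hp'
  apply hq0
  apply Subtype.ext
  rw [← hp, hp0]
  simp

/-- Each strict inclusion of primes supplies one more independent element: an element of the second
prime outside the first is nonzero modulo the first and dies modulo the second. Working modulo the
first prime of the chain is what makes the induction run. -/
theorem exists_algebraicIndependent_of_ltSeries {k R : Type*} [Field k] [CommRing R]
    [Algebra k R] (m : ℕ) (p : LTSeries (PrimeSpectrum R)) (hm : p.length = m) :
    ∃ y : Fin m → R,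
      AlgebraicIndependent k fun i => Ideal.Quotient.mk p.head.asIdeal (y i) := by
  induction m generalizing p with
  | zero =>
    refine ⟨Fin.elim0, ?_⟩
    rw [algebraicIndependent_empty_type_iff]
    exact (algebraMap k (R ⧸ p.head.asIdeal)).injective
  | succ m ih =>
    have hne : p.length ≠ 0 := by omega
    obtain ⟨y, hy⟩ := ih (p.tail hne) (by simp [RelSeries.tail_length, hm])
    have hlt : p.head < (p.tail hne).head := by
      rw [RelSeries.head_tail]
      have : (0 : Fin (p.length + 1)) < 1 := by
        rw [Fin.lt_def]
        obtain ⟨l, hl⟩ := Nat.exists_eq_succ_of_ne_zero hne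
        simp [hl]
      exact p.strictMono this
    obtain ⟨x, hx1, hx0⟩ := SetLike.exists_of_lt (show p.head.asIdeal < _ from hlt)
    let f := Ideal.Quotient.factorₐ k (show p.head.asIdeal ≤ (p.tail hne).head.asIdeal from hlt.le)
    have h := AlgebraicIndependent.option_of_mem_ker f
      (y := fun i => Ideal.Quotient.mk p.head.asIdeal (y i))
      (x := Ideal.Quotient.mk p.head.asIdeal x) hy
      (by rwa [Ne, Ideal.Quotient.eq_zero_iff_mem])
      (by
        change Ideal.Quotient.mk (p.tail hne).head.asIdeal x = 0
        rwa [Ideal.Quotient.eq_zero_iff_mem])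
    let e : Fin (m + 1) ≃ Option (Fin m) := finSuccEquiv m
    refine ⟨fun i => (e i).elim x y, ?_⟩
    have h' := (algebraicIndependent_equiv e).mpr h
    have key : (fun i => Ideal.Quotient.mk p.head.asIdeal ((e i).elim x y)) =
        (fun o : Option (Fin m) => o.elim (Ideal.Quotient.mk p.head.asIdeal x)
          fun i => Ideal.Quotient.mk p.head.asIdeal (y i)) ∘ e := by
      ext i
      simp only [Function.comp]
      cases e i <;> rfl
    rw [key]
    exact h'

theorem ringKrullDim_le_toENat_trdeg (k R : Type*) [Field k] [CommRing R] [IsDomain R]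
    [Algebra k R] : ringKrullDim R ≤ (Cardinal.toENat (Algebra.trdeg k R) : WithBot ℕ∞) := by
  refine iSup_le fun p => ?_
  obtain ⟨y, hy⟩ := exists_algebraicIndependent_of_ltSeries (k := k) p.length p rfl
  have hy' : AlgebraicIndependent k y :=
    AlgebraicIndependent.of_comp (Ideal.Quotient.mkₐ k p.head.asIdeal) hy
  have h := hy'.lift_cardinalMk_le_trdeg
  have h2 := OrderHomClass.mono (Cardinal.toENat) h
  simp only [Cardinal.mk_fin, Cardinal.lift_natCast, map_natCast, Cardinal.toENat_lift] at h2
  exact_mod_cast h2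

/-- `S(V)` is a polynomial ring on a basis of `V`, and passing to fractions is an algebraic
extension. `Cardinal.toENat` sends every infinite rank to `⊤`, so the bound is then vacuous. -/
theorem ringKrullDim_le_of_injective_fractionRing_symmetricAlgebra {k V R : Type*} [Field k]
    [AddCommGroup V] [Module k V] [CommRing R] [Algebra k R]
    (f : R →ₐ[k] FractionRing (SymmetricAlgebra k V)) (hf : Function.Injective f) :
    ringKrullDim R ≤ (Cardinal.toENat (Module.rank k V) : WithBot ℕ∞) := by
  have : IsDomain R := hf.isDomain f.toRingHom
  refine (ringKrullDim_le_toENat_trdeg k R).trans ?_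
  have h1 := OrderHomClass.mono Cardinal.toENat (lift_trdeg_le_of_injective f hf)
  have : Algebra.IsAlgebraic (SymmetricAlgebra k V) (FractionRing (SymmetricAlgebra k V)) :=
    IsLocalization.isAlgebraic _ (nonZeroDivisors (SymmetricAlgebra k V))
  have h2 : Algebra.trdeg k (FractionRing (SymmetricAlgebra k V)) =
      Algebra.trdeg k (SymmetricAlgebra k V) := by
    rw [← trdeg_add_eq k (SymmetricAlgebra k V),
      trdeg_eq_zero (R := SymmetricAlgebra k V) (A := FractionRing (SymmetricAlgebra k V)), add_zero]
  have h3 := congrArg Cardinal.toENat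
    (SymmetricAlgebra.equivMvPolynomial (Module.Basis.ofVectorSpace k V)).lift_trdeg_eq
  have h4 := congrArg Cardinal.toENat (Module.Basis.ofVectorSpace k V).mk_eq_rank
  rw [MvPolynomial.trdeg_of_isDomain] at h3
  simp only [Cardinal.toENat_lift] at h1 h3 h4
  rw [h2, h3, h4] at h1
  exact_mod_cast h1

end KrullDimension

namespace GenericHopf

/-! ### Convolution operators -/

theorem range_lTensor_mono {k M C : Type*} [Field k] [AddCommGroup M] [Module k M]
    [AddCommGroup C] [Module k C] {V W : Submodule k C} (h : V ≤ W) :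
    LinearMap.range (V.subtype.lTensor M) ≤ LinearMap.range (W.subtype.lTensor M) := by
  rintro _ ⟨y, rfl⟩
  exact ⟨(Submodule.inclusion h).lTensor M y, by
    rw [← LinearMap.lTensor_comp_apply, Submodule.subtype_comp_inclusion]⟩

section ConvEnd

open WithConv

variable {k C K : Type*} [Field k] [AddCommGroup C] [Module k C] [Coalgebra k C]
  [CommRing K] [Algebra k K]

/-- The `K`-linear operator `a ⊗ x ↦ a f(x₁) ⊗ x₂` on `K ⊗ C`. -/
def convEnd (f : C →ₗ[k] K) : K ⊗[k] C →ₗ[K] K ⊗[k] C :=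
  LinearMap.liftBaseChange K (f.rTensor C ∘ₗ comul)

theorem convEnd_tmul (f : C →ₗ[k] K) (a : K) (x : C) :
    convEnd f (a ⊗ₜ x) = a • f.rTensor C (comul (R := k) x) := by
  simp [convEnd]

/-- By coassociativity, both sides send `1 ⊗ x` to `f(x₁) g(x₂) ⊗ x₃`. Convolution becomes
composition in the reverse order, which reduces invertibility to linear algebra over `K`. -/
theorem convEnd_convEnd (f g : C →ₗ[k] K) (w : K ⊗[k] C) :
    convEnd g (convEnd f w) = convEnd (toConv f * toConv g).ofConv w := by
  let Ψ : C ⊗[k] (C ⊗[k] C) →ₗ[k] K ⊗[k] C :=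
    (LinearMap.mul' k K ∘ₗ TensorProduct.map f g).rTensor C ∘ₗ
      (TensorProduct.assoc k C C C).symm.toLinearMap
  have h1 : ∀ s : C ⊗[k] C, convEnd g (f.rTensor C s) = Ψ (comul.lTensor C s) := by
    intro s
    induction s using TensorProduct.induction_on with
    | zero => simp
    | add x y hx hy => simp only [map_add, hx, hy]
    | tmul a b =>
      simp only [LinearMap.rTensor_tmul, LinearMap.lTensor_tmul, convEnd_tmul]
      generalize comul (R := k) b = r
      induction r using TensorProduct.induction_on with
      | zero => simp
      | add x y hx hy => simp only [TensorProduct.tmul_add, smul_add, map_add, hx, hy]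
      | tmul c d => simp [Ψ, TensorProduct.smul_tmul']
  have h2 : ∀ s : C ⊗[k] C, (toConv f * toConv g).ofConv.rTensor C s =
      Ψ (TensorProduct.assoc k C C C (comul.rTensor C s)) := by
    intro s
    simp only [Ψ, LinearMap.comp_apply, LinearEquiv.coe_coe, LinearEquiv.symm_apply_apply,
      ← LinearMap.rTensor_comp_apply]
    rfl
  induction w using TensorProduct.induction_on with
  | zero => simp
  | add x y hx hy => simp only [map_add, hx, hy]
  | tmul a x =>
    rw [convEnd_tmul, convEnd_tmul, map_smul, h1, h2, Coalgebra.coassoc_apply]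

theorem convEnd_one (w : K ⊗[k] C) :
    convEnd (1 : WithConv (C →ₗ[k] K)).ofConv w = w := by
  induction w using TensorProduct.induction_on with
  | zero => simp
  | add x y hx hy => simp only [map_add, hx, hy]
  | tmul a x =>
    rw [convEnd_tmul, LinearMap.convOne_def, ofConv_toConv, LinearMap.rTensor_comp_apply,
      Coalgebra.rTensor_counit_comul]
    simp [TensorProduct.smul_tmul']

/-- The `K`-linear extension `K ⊗ C → K` of a linear map `C → K`. -/
abbrev extend (f : C →ₗ[k] K) : K ⊗[k] C →ₗ[K] K := LinearMap.liftBaseChange K f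

theorem extend_convEnd (f g : C →ₗ[k] K) (x : C) :
    extend g (convEnd f (1 ⊗ₜ x)) = (toConv f * toConv g) x := by
  rw [convEnd_tmul, one_smul, (ℛ k x).convMul_apply, ← (ℛ k x).eq]
  simp

theorem convEnd_injective : Function.Injective (convEnd : (C →ₗ[k] K) → _) := by
  intro f g h
  -- Applying the counit to the second factor of `f(x₁) ⊗ x₂` recovers `f(x)`.
  have key : ∀ f : C →ₗ[k] K, ∀ x, f x =
      extend (1 : WithConv (C →ₗ[k] K)).ofConv (convEnd f (1 ⊗ₜ x)) := by
    intro f x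
    rw [extend_convEnd, toConv_ofConv, mul_one]
  ext x
  rw [key f, key g, h]

theorem isUnit_toConv_of_bijective (f : C →ₗ[k] K) (h : Function.Bijective (convEnd f)) :
    IsUnit (toConv f) := by
  let e := LinearEquiv.ofBijective (convEnd f) h
  -- By the same recipe, the candidate inverse is the counit applied to the inverse operator.
  let s : C →ₗ[k] K := ((extend (1 : WithConv (C →ₗ[k] K)).ofConv ∘ₗ e.symm.toLinearMap :
    K ⊗[k] C →ₗ[K] K).restrictScalars k) ∘ₗ TensorProduct.mk k K C 1
  have hs : extend s = extend (1 : WithConv (C →ₗ[k] K)).ofConv ∘ₗ e.symm.toLinearMap := by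
    ext x
    simp [s]
  have h1 : toConv f * toConv s = 1 := by
    ext x
    rw [← extend_convEnd, hs, LinearMap.comp_apply]
    have : e.symm (convEnd f (1 ⊗ₜ x)) = 1 ⊗ₜ x := e.symm_apply_apply _
    rw [LinearEquiv.coe_coe, this]
    simp
  have h2 : toConv s * toConv f = 1 := by
    apply ofConv_injective
    apply convEnd_injective
    ext1
    ext x
    -- With `F`, `G` the operators of `f`, `s`, the identity `G ∘ F = 1` is known; surjectivity of
    -- `F` then gives `F ∘ G = 1`.
    obtain ⟨w, hw⟩ := h.2 (1 ⊗ₜ x)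
    simp only [TensorProduct.AlgebraTensorModule.curry_apply, 
      TensorProduct.curry_apply, LinearMap.coe_restrictScalars]
    rw [← convEnd_convEnd, ← hw, convEnd_convEnd f s, h1, convEnd_one, convEnd_one]
  exact ⟨⟨toConv f, toConv s, h1, h2⟩, rfl⟩

/-! ### Local finiteness -/

/-- `V` is a left subcomodule of the coalgebra `C`. -/
def IsSubcomodule (V : Submodule k C) : Prop :=
  ∀ v ∈ V, comul (R := k) v ∈ LinearMap.range (V.subtype.lTensor C)

theorem IsSubcomodule.sup {V W : Submodule k C} (hV : IsSubcomodule V) (hW : IsSubcomodule W) :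
    IsSubcomodule (V ⊔ W) := by
  intro v hv
  obtain ⟨a, ha, b, hb, rfl⟩ := Submodule.mem_sup.mp hv
  rw [map_add]
  exact add_mem (range_lTensor_mono le_sup_left (hV a ha))
    (range_lTensor_mono le_sup_right (hW b hb))

/-- If `Δ(x) = ∑ Bᵢ ⊗ cᵢ` over a basis `B`, the span of the finitely many nonzero `cᵢ` works: `cᵢ =
Bᵢ*(x₁) x₂`, so coassociativity puts `Δ(cᵢ)` in `C ⊗ span c`, and the counit puts `x` in the span.
-/
theorem exists_subcomodule_mem (x : C) :
    ∃ V : Submodule k C, IsSubcomodule V ∧ Module.Finite k V ∧ x ∈ V := by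
  let B := Module.Basis.ofVectorSpace k C
  obtain ⟨c, hc⟩ := TensorProduct.eq_repr_basis_left B (comul (R := k) x)
  have htw : ∀ f : C →ₗ[k] k, twist f x = c.sum fun i n => f (B i) • n := by
    intro f
    simp [twist, ← hc, Finsupp.sum]
  have hcx : ∀ i, c i = twist (B.coord i) x := by
    intro i
    rw [htw, Finsupp.sum, Finset.sum_eq_single i]
    · simp
    · intro j _ hj
      simp [hj]
    · intro hi
      simp [Finsupp.notMem_support_iff.mp hi]
  have hmem : ∀ f : C →ₗ[k] k, twist f x ∈ Submodule.span k (Set.range c) := by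
    intro f
    rw [htw]
    exact sum_mem fun i _ => Submodule.smul_mem _ _ (Submodule.subset_span ⟨i, rfl⟩)
  refine ⟨Submodule.span k (Set.range c), ?_, ?_, ?_⟩
  · intro v hv
    refine (Submodule.span_le (p := (LinearMap.range ((Submodule.span k
      (Set.range c)).subtype.lTensor C)).comap (comul (R := k)))).mpr ?_ hv
    rintro _ ⟨i, rfl⟩
    rw [SetLike.mem_coe, Submodule.mem_comap, hcx, comul_twist, ← hc, Finsupp.sum, map_sum]
    refine sum_mem fun j _ => ⟨twist (B.coord i) (B j) ⊗ₜ
      ⟨c j, Submodule.subset_span ⟨j, rfl⟩⟩, by simp⟩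
  · exact Module.Finite.span_of_finite k c.finite_range
  · have h := hmem counit
    rwa [twist_counit] at h

theorem exists_subcomodule_mem_range (w : K ⊗[k] C) :
    ∃ V : Submodule k C, IsSubcomodule V ∧ Module.Finite k V ∧
      w ∈ LinearMap.range (V.subtype.lTensor K) := by
  induction w using TensorProduct.induction_on with
  | zero =>
    obtain ⟨V, hV, hfin, -⟩ := exists_subcomodule_mem (k := k) (0 : C)
    exact ⟨V, hV, hfin, zero_mem _⟩
  | tmul a x =>
    obtain ⟨V, hV, hfin, hx⟩ := exists_subcomodule_mem (k := k) x
    exact ⟨V, hV, hfin, a ⊗ₜ ⟨x, hx⟩, by simp⟩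
  | add x y hx hy =>
    obtain ⟨V, hV, hfin, a, rfl⟩ := hx
    obtain ⟨W, hW, hfin', b, rfl⟩ := hy
    refine ⟨V ⊔ W, hV.sup hW, inferInstance, ?_⟩
    refine add_mem ⟨(Submodule.inclusion le_sup_left).lTensor K a, ?_⟩
      ⟨(Submodule.inclusion le_sup_right).lTensor K b, ?_⟩ <;>
    rw [← LinearMap.lTensor_comp_apply, Submodule.subtype_comp_inclusion]

/-! ### Invertibility by specialization -/

/-- The matrix coefficients of a finite-dimensional subcomodule. -/
theorem IsSubcomodule.exists_coefficients {V : Submodule k C} (hV : IsSubcomodule V) {ι : Type*}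
    [Fintype ι] [DecidableEq ι] (b : Module.Basis ι k V) : ∃ e : ι → ι → C,
      (∀ j, comul (R := k) (b j : C) = ∑ i, e i j ⊗ₜ[k] (b i : C)) ∧
      ∀ i j, counit (R := k) (e i j) = if i = j then 1 else 0 := by
  have h1 : ∀ j, ∃ d : ι →₀ C, comul (R := k) (b j : C) = ∑ i, d i ⊗ₜ[k] (b i : C) := by
    intro j
    obtain ⟨y, hy⟩ := hV (b j) (b j).2
    obtain ⟨d, hd⟩ := TensorProduct.eq_repr_basis_right b y
    refine ⟨d, ?_⟩
    rw [← hy, ← hd, Finsupp.sum_fintype _ _ (by simp)]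
    simp
  choose d hd using h1
  refine ⟨fun i j => d j i, hd, fun i j => ?_⟩
  have h2 := Coalgebra.rTensor_counit_comul (R := k) (b j : C)
  rw [hd] at h2
  have h3 := congrArg (TensorProduct.lid k C) h2
  simp only [map_sum, LinearMap.rTensor_tmul, TensorProduct.lid_tmul, one_smul] at h3
  have h4 : ∑ l, counit (R := k) (d j l) • b l = b j := Subtype.ext (by simpa using h3)
  have h5 := congrArg (fun v => b.repr v i) h4
  simpa [Finsupp.single_apply, eq_comm] using h5

/-- The operator preserves `L ⊗ V` for each finite-dimensional subcomodule `V`, with matrix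
`j(f(eᵢⱼ))`. The determinant of `f(eᵢⱼ)` is sent by `g` to `det ε(eᵢⱼ) = 1`, so it is nonzero and
its image is invertible in the field `L`. These `L ⊗ V` exhaust `L ⊗ C`. -/
theorem isUnit_toConv_of_specialization {S L : Type*} [CommRing S] [Algebra k S] [Field L]
    [Algebra k L] (f : C →ₗ[k] S) (g : S →ₐ[k] k) (hg : ∀ x, g (f x) = counit (R := k) x)
    (j : S →ₐ[k] L) (hj : Function.Injective j) : IsUnit (toConv (j.toLinearMap ∘ₗ f)) := by
  classical
  apply isUnit_toConv_of_bijective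
  set φ := convEnd (j.toLinearMap ∘ₗ f) with hφ
  have key : ∀ V : Submodule k C, IsSubcomodule V → Module.Finite k V →
      ∃ ψ : L ⊗[k] V →ₗ[L] L ⊗[k] V, Function.Bijective ψ ∧
        ∀ w, φ (V.subtype.lTensor L w) = V.subtype.lTensor L (ψ w) := by
    intro V hV hfin
    let b := Module.finBasis k V
    obtain ⟨e, he, hε⟩ := hV.exists_coefficients b
    let M : Matrix _ _ S := Matrix.of fun i j => f (e i j)
    have hM : (M.map j).det ≠ 0 := by
      have h1 : (M.map g).det = 1 := by
        have : M.map g = 1 := by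
          ext i l
          simp [M, hg, hε, Matrix.one_apply]
        rw [this, Matrix.det_one]
      have h2 : g M.det = (M.map g).det := AlgHom.map_det g M
      have h3 : j M.det = (M.map j).det := AlgHom.map_det j M
      rw [← h3]
      intro h0
      have h4 : M.det = 0 := hj (by rw [h0, map_zero])
      rw [h4, map_zero, h1] at h2
      exact zero_ne_one h2
    let bL := b.baseChange L
    refine ⟨Matrix.toLin bL bL (M.map j), ?_, ?_⟩
    · have hu : IsUnit (M.map j) := (Matrix.isUnit_iff_isUnit_det _).mpr hM.isUnit
      have := (Matrix.isUnit_toLin_iff bL).mpr hu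
      exact (Module.End.isUnit_iff _).mp this
    · have hlin : φ ∘ₗ V.subtype.baseChange L =
          V.subtype.baseChange L ∘ₗ Matrix.toLin bL bL (M.map j) := by
        apply bL.ext
        intro i
        simp only [LinearMap.comp_apply, Matrix.toLin_self]
        simp [bL, hφ, convEnd_tmul, he, M, TensorProduct.smul_tmul']
      intro w
      exact LinearMap.congr_fun hlin w
  constructor
  · rw [injective_iff_map_eq_zero]
    intro w hw
    obtain ⟨V, hV, hfin, y, rfl⟩ := exists_subcomodule_mem_range w
    obtain ⟨ψ, hψ, h⟩ := key V hV hfin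
    rw [h] at hw
    have h1 : ψ y = 0 := Module.Flat.lTensor_preserves_injective_linearMap V.subtype
      V.subtype_injective (by rw [hw, map_zero])
    rw [hψ.1 (h1.trans (map_zero ψ).symm), map_zero]
  · intro w
    obtain ⟨V, hV, hfin, y, rfl⟩ := exists_subcomodule_mem_range w
    obtain ⟨ψ, hψ, h⟩ := key V hV hfin
    obtain ⟨z, rfl⟩ := hψ.2 y
    exact ⟨_, h z⟩

end ConvEnd

/-! ### The universal map and the ideal of identities -/

section UniversalMap

variable {k : Type*} [Field k] {H : Type*} [Ring H] [Bialgebra k H] (α : TwoCocycle k H)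

theorem TwoCocycle.universalMap_ι (x : H) : α.universalMap (TensorAlgebra.ι k x) =
    TensorProduct.map (SymmetricAlgebra.ι k H) α.u.toLinearMap (comul (R := k) x) := by
  simp [TwoCocycle.universalMap]

/-- The specialization `S(t_H) ⊗ ᵅH → ᵅH` at a linear form on `H`. -/
def TwoCocycle.specialize (l : H →ₗ[k] k) :
    SymmetricAlgebra k H ⊗[k] α.TwistedAlgebra →ₐ[k] α.TwistedAlgebra :=
  (Algebra.TensorProduct.lid k α.TwistedAlgebra).toAlgHom.comp
    (Algebra.TensorProduct.map (SymmetricAlgebra.lift l) (AlgHom.id k α.TwistedAlgebra))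

theorem TwoCocycle.specialize_tmul (l : H →ₗ[k] k) (s : SymmetricAlgebra k H)
    (a : α.TwistedAlgebra) :
    α.specialize l (s ⊗ₜ a) = SymmetricAlgebra.lift l s • a := by
  simp [TwoCocycle.specialize]

theorem TwoCocycle.specialize_universalMap_ι (l : H →ₗ[k] k) (x : H) :
    α.specialize l (α.universalMap (TensorAlgebra.ι k x)) = α.u (twist l x) := by
  rw [universalMap_ι, twist_repr l x (ℛ k x), ← (ℛ k x).eq]
  simp [specialize_tmul]

theorem TwoCocycle.coaction_u (x : H) :
    ComoduleAlgebra.coaction (k := k) (H := H) (α.u x) =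
      α.u.toLinearMap.rTensor H (comul (R := k) x) :=
  α.coactionLin_u x

theorem coaction_tensorAlgebra_ι (x : H) :
    ComoduleAlgebra.coaction (k := k) (H := H) (TensorAlgebra.ι k x) =
      (TensorAlgebra.ι k).rTensor H (comul (R := k) x) :=
  tensorCoaction_ι k H x

theorem TwoCocycle.isComoduleAlgHom_specialize (l : H →ₗ[k] k) :
    IsComoduleAlgHom H ((α.specialize l).comp α.universalMap) := by
  set F := (α.specialize l).comp α.universalMap with hF
  have h : (ComoduleAlgebra.coaction (k := k) (H := H) (A := α.TwistedAlgebra)).comp F =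
      (Algebra.TensorProduct.map F (AlgHom.id k H)).comp
        (ComoduleAlgebra.coaction (k := k) (H := H) (A := TensorAlgebra k H)) := by
    apply TensorAlgebra.hom_ext
    ext x
    have h1 : F (TensorAlgebra.ι k x) = α.u (twist l x) := α.specialize_universalMap_ι l x
    have h2 : F.toLinearMap ∘ₗ TensorAlgebra.ι k = α.u.toLinearMap ∘ₗ twist l := by
      ext y
      exact α.specialize_universalMap_ι l y
    change ComoduleAlgebra.coaction (F (TensorAlgebra.ι k x)) =
      F.toLinearMap.rTensor H (ComoduleAlgebra.coaction (TensorAlgebra.ι k x))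
    rw [h1, coaction_u, comul_twist, coaction_tensorAlgebra_ι, ← LinearMap.rTensor_comp_apply,
      ← LinearMap.rTensor_comp_apply, h2]
  exact fun a => DFunLike.congr_fun h a

/-- A comodule map is recovered from its composite with the counit: if `f(X_x) = u_y`, colinearity
computes `Δ(y)`, and `ε ⊗ id` yields `y = l(x₁) x₂`. -/
theorem TwoCocycle.eq_specialize (f : TensorAlgebra k H →ₐ[k] α.TwistedAlgebra)
    (hf : IsComoduleAlgHom H f) :
    f = (α.specialize (counit ∘ₗ α.u.symm.toLinearMap ∘ₗ f.toLinearMap ∘ₗ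
      TensorAlgebra.ι k)).comp α.universalMap := by
  apply TensorAlgebra.hom_ext
  ext x
  change f (TensorAlgebra.ι k x) = α.specialize _ (α.universalMap (TensorAlgebra.ι k x))
  rw [specialize_universalMap_ι, twist_repr _ x (ℛ k x)]
  have h1 := hf (TensorAlgebra.ι k x)
  obtain ⟨y, hy⟩ := α.u.surjective (f (TensorAlgebra.ι k x))
  rw [← hy, coaction_u, coaction_tensorAlgebra_ι, ← (ℛ k x).eq] at h1
  have h2 := congrArg (fun w => TensorProduct.lid k H
    ((counit ∘ₗ α.u.symm.toLinearMap : α.TwistedAlgebra →ₗ[k] k).rTensor H w)) h1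
  have h3 : (counit ∘ₗ α.u.symm.toLinearMap) ∘ₗ α.u.toLinearMap = (counit : H →ₗ[k] k) := by
    ext; simp
  simp only [← LinearMap.rTensor_comp_apply, h3, Coalgebra.rTensor_counit_comul] at h2
  rw [← hy]
  congr 1
  simpa using h2

/-- In a basis of `V`, linear forms are the points of affine space, and a polynomial vanishing at
all points over an infinite field is zero. -/
theorem symmetricAlgebra_eq_zero_of_lift_eq_zero [Infinite k] {V : Type*} [AddCommGroup V]
    [Module k V] (s : SymmetricAlgebra k V)
    (h : ∀ l : V →ₗ[k] k, SymmetricAlgebra.lift l s = 0) : s = 0 := by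
  let b := Module.Basis.ofVectorSpace k V
  let e := SymmetricAlgebra.equivMvPolynomial b
  apply e.injective
  rw [map_zero]
  refine MvPolynomial.funext fun x => ?_
  have h1 : (MvPolynomial.aeval x).comp e.toAlgHom = SymmetricAlgebra.lift (b.constr k x) := by
    apply SymmetricAlgebra.algHom_ext
    refine b.ext fun i => ?_
    simp [e]
  have h2 := DFunLike.congr_fun h1 s
  rw [h] at h2
  rw [map_zero]
  simpa [MvPolynomial.aeval_eq_eval] using h2

theorem TwoCocycle.eq_zero_of_specialize_eq_zero [Infinite k]
    (w : SymmetricAlgebra k H ⊗[k] α.TwistedAlgebra) (h : ∀ l, α.specialize l w = 0) : w = 0 := by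
  let b := Module.Basis.ofVectorSpace k α.TwistedAlgebra
  obtain ⟨c, rfl⟩ := TensorProduct.eq_repr_basis_right b w
  have hc : ∀ i, c i = 0 := by
    intro i
    refine symmetricAlgebra_eq_zero_of_lift_eq_zero _ fun l => ?_
    have h1 := h l
    simp only [Finsupp.sum, map_sum, specialize_tmul] at h1
    by_cases hi : i ∈ c.support
    · exact linearIndependent_iff'.mp b.linearIndependent _ _ h1 i hi
    · rw [Finsupp.notMem_support_iff.mp hi, map_zero]
  rw [show c = 0 from Finsupp.ext hc, Finsupp.sum_zero_index]

theorem TwoCocycle.mem_identityIdeal_iff [Infinite k] (P : TensorAlgebra k H) :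
    P ∈ identityIdeal k H α.TwistedAlgebra ↔ α.universalMap P = 0 := by
  rw [mem_identityIdeal]
  constructor
  · intro h
    exact α.eq_zero_of_specialize_eq_zero _ fun l => h _ (α.isComoduleAlgHom_specialize l)
  · intro h f hf
    rw [α.eq_specialize f hf, AlgHom.comp_apply, h, map_zero]

/-- The map `U_H^α → S(t_H) ⊗ ᵅH` induced by the universal comodule algebra map. -/
def TwoCocycle.universalMapBar [Infinite k] : UniversalAlgebra k H α.TwistedAlgebra →ₐ[k]
    SymmetricAlgebra k H ⊗[k] α.TwistedAlgebra :=
  Ideal.Quotient.liftₐ _ α.universalMap fun P hP => (α.mem_identityIdeal_iff P).mp hP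

theorem TwoCocycle.universalMapBar_mk [Infinite k] (P : TensorAlgebra k H) :
    α.universalMapBar (Ideal.Quotient.mk (identityIdeal k H α.TwistedAlgebra) P) =
      α.universalMap P :=
  rfl

theorem TwoCocycle.universalMapBar_injective [Infinite k] :
    Function.Injective α.universalMapBar := by
  rw [injective_iff_map_eq_zero]
  intro z hz
  obtain ⟨P, rfl⟩ := Ideal.Quotient.mk_surjective z
  rw [universalMapBar_mk] at hz
  exact Ideal.Quotient.eq_zero_iff_mem.mpr ((α.mem_identityIdeal_iff P).mpr hz)

end UniversalMap

/-! ### The center of the universal comodule algebra -/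

section Center

open WithConv

variable {k : Type*} [Field k] {H : Type*} [Ring H] [Bialgebra k H]

theorem toFracS_injective : Function.Injective (toFracS k H) :=
  IsFractionRing.injective (SymmetricAlgebra k H) (FracS k H)

theorem isUnit_genT : IsUnit (toConv (genT k H)) :=
  isUnit_toConv_of_specialization (SymmetricAlgebra.ι k H) (SymmetricAlgebra.lift counit)
    (fun x => by simp) (toFracS k H) toFracS_injective

theorem genT_mul_genTInv : toConv (genT k H) * toConv (genTInv k H) = 1 := by
  rw [genTInv, toConv_ofConv]
  exact Ring.mul_inverse_cancel _ isUnit_genT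

theorem genTInv_mul_genT : toConv (genTInv k H) * toConv (genT k H) = 1 := by
  rw [genTInv, toConv_ofConv]
  exact Ring.inverse_mul_cancel _ isUnit_genT

theorem convMul_apply_one {D A : Type*} [Ring D] [Bialgebra k D] [Ring A] [Algebra k A]
    (f g : WithConv (D →ₗ[k] A)) : (f * g) 1 = f 1 * g 1 := by
  simp [Algebra.TensorProduct.one_def]

theorem genT_one_mul_genTInv_one : genT k H 1 * genTInv k H 1 = 1 := by
  have h := convMul_apply_one (toConv (genT k H)) (toConv (genTInv k H))
  rw [genT_mul_genTInv] at h
  simpa using h.symm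

theorem convEnd_genT_bijective : Function.Bijective (convEnd (genT k H)) := by
  rw [Function.bijective_iff_has_inverse]
  refine ⟨convEnd (genTInv k H), fun w => ?_, fun w => ?_⟩
  · rw [convEnd_convEnd, genT_mul_genTInv, convEnd_one]
  · rw [convEnd_convEnd, genTInv_mul_genT, convEnd_one]

variable (α : TwoCocycle k H)

/-- The element `v_x = t_{x₁} ⊗ u_{x₂}` of `Frac S(t_H) ⊗ ᵅH`. -/
def TwoCocycle.genericElement : H →ₗ[k] FracS k H ⊗[k] α.TwistedAlgebra :=
  TensorProduct.map (genT k H) α.u.toLinearMap ∘ₗ comul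

theorem TwoCocycle.inclFrac_universalMap_ι (x : H) :
    α.inclFrac (α.universalMap (TensorAlgebra.ι k x)) = α.genericElement x := by
  rw [universalMap_ι, genericElement, LinearMap.comp_apply, ← (ℛ k x).eq]
  simp [inclFrac, genT]

theorem TwoCocycle.inclFrac_injective : Function.Injective α.inclFrac :=
  Module.Flat.rTensor_preserves_injective_linearMap (M := α.TwistedAlgebra)
    (toFracS k H).toLinearMap toFracS_injective

theorem TwoCocycle.genericElement_eq (x : H) :
    α.genericElement x = α.u.toLinearMap.baseChange (FracS k H) (convEnd (genT k H) (1 ⊗ₜ x)) := by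
  rw [convEnd_tmul, genericElement, LinearMap.comp_apply, ← (ℛ k x).eq]
  simp

/-- This is the surjectivity of the operator attached to `t`, since that operator sends `1 ⊗ x` to
`v_x` up to the identification of `H` with `ᵅH`. -/
theorem TwoCocycle.span_genericElement :
    Submodule.span (FracS k H) (Set.range α.genericElement) = ⊤ := by
  rw [eq_top_iff]
  intro w _
  have hsurj : Function.Surjective
      (α.u.toLinearMap.baseChange (FracS k H) ∘ₗ convEnd (genT k H)) := by
    rw [LinearMap.coe_comp]
    exact (LinearMap.lTensor_surjective (FracS k H) α.u.surjective).comp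
      convEnd_genT_bijective.2
  obtain ⟨z, rfl⟩ := hsurj w
  induction z using TensorProduct.induction_on with
  | zero => simp
  | add x y hx hy =>
    rw [map_add]
    exact add_mem (hx trivial) (hy trivial)
  | tmul a x =>
    have h : a ⊗ₜ[k] x = a • ((1 : FracS k H) ⊗ₜ[k] x) := by simp [TensorProduct.smul_tmul']
    rw [h, map_smul, LinearMap.comp_apply, ← genericElement_eq]
    exact Submodule.smul_mem _ _ (Submodule.subset_span ⟨x, rfl⟩)

/-- Commuting with `1 ⊗ a` can be tested on the coordinates along a basis of `K`, so each coordinate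
is central in `A`, hence a scalar. -/
theorem exists_eq_tmul_one_of_commute {k K A : Type*} [Field k] [CommRing K] [Algebra k K]
    [Ring A] [Algebra k A] (hA : Subalgebra.center k A = ⊥) (w : K ⊗[k] A)
    (hw : ∀ a : A, Commute w (1 ⊗ₜ a)) : ∃ b : K, w = b ⊗ₜ 1 := by
  let B := Module.Basis.ofVectorSpace k K
  obtain ⟨c, rfl⟩ := TensorProduct.eq_repr_basis_left B w
  have hc : ∀ i, ∃ r : k, c i = algebraMap k A r := by
    intro i
    have h : c i ∈ Subalgebra.center k A := by
      rw [Subalgebra.mem_center_iff]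
      intro a
      have h1 := (hw a).eq
      simp only [Finsupp.sum, Finset.sum_mul, Finset.mul_sum,
        Algebra.TensorProduct.tmul_mul_tmul, mul_one, one_mul] at h1
      have h2 := congrArg (fun z => TensorProduct.lid k A ((B.coord i).rTensor A z)) h1
      simp only [map_sum, LinearMap.rTensor_tmul, TensorProduct.lid_tmul, Module.Basis.coord_apply,
        Module.Basis.repr_self] at h2
      by_cases hi : i ∈ c.support
      · rw [Finset.sum_eq_single i, Finset.sum_eq_single i] at h2
        · simpa using h2.symm
        all_goals simp +contextual [hi]
      · simp [Finsupp.notMem_support_iff.mp hi]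
    rw [hA, Algebra.mem_bot] at h
    obtain ⟨r, hr⟩ := h
    exact ⟨r, hr.symm⟩
  choose r hr using hc
  refine ⟨∑ i ∈ c.support, r i • B i, ?_⟩
  rw [Finsupp.sum, TensorProduct.sum_tmul]
  refine Finset.sum_congr rfl fun i _ => ?_
  rw [hr, Algebra.algebraMap_eq_smul_one, TensorProduct.tmul_smul, TensorProduct.smul_tmul']

theorem TwoCocycle.exists_eq_tmul_one (hα : α.IsNondegenerate)
    (w : FracS k H ⊗[k] α.TwistedAlgebra) (hw : ∀ x, Commute w (α.genericElement x)) :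
    ∃ b : FracS k H, w = b ⊗ₜ 1 := by
  refine exists_eq_tmul_one_of_commute (Subalgebra.eq_bot_of_finrank_one hα) w fun a => ?_
  have h : (1 : FracS k H) ⊗ₜ[k] a ∈ Submodule.span (FracS k H) (Set.range α.genericElement) := by
    rw [span_genericElement]
    trivial
  refine Submodule.span_induction ?_ ?_ ?_ ?_ h
  · rintro _ ⟨x, rfl⟩
    exact hw x
  · exact Commute.zero_right w
  · exact fun _ _ _ _ hx hy => hx.add_right hy
  · exact fun c _ _ hx => hx.smul_right c

/-! ### The product of generic elements -/

theorem TwoCocycle.convMul_u_mul :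
    toConv (Algebra.linearMap k α.TwistedAlgebra ∘ₗ α.lin) *
      toConv (α.u.toLinearMap ∘ₗ LinearMap.mul' k H) =
    toConv (α.u.toLinearMap ∘ₗ α.mulLin) := by
  ext1
  refine LinearMap.ext fun c => ?_
  change (toConv (Algebra.linearMap k α.TwistedAlgebra ∘ₗ α.lin) *
      toConv (α.u.toLinearMap ∘ₗ LinearMap.mul' k H)) c = α.u (α.mulLin c)
  rw [(ℛ k c).convMul_apply, mulLin, LinearMap.comp_apply, twist_repr _ c (ℛ k c)]
  simp [Algebra.algebraMap_eq_smul_one]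

/-- Among maps from `H ⊗ H` to `K ⊗ ᵅH` under convolution, with `m` the product of `H`, one has `σ *
(v ∘ m) = (f ⊗ f) * α * (g ∘ m) * (f ∘ m) * (u ∘ m)`. The middle pair `(g ∘ m) * (f ∘ m)` cancels,
and `α * (u ∘ m)` is the twisted product. -/
theorem TwoCocycle.twisted_mul {K : Type*} [CommRing K] [Algebra k K] (f g : H →ₗ[k] K)
    (hgf : toConv g * toConv f = 1) (σ : H ⊗[k] H →ₗ[k] K)
    (hσ : toConv σ = toConv (LinearMap.mul' k K ∘ₗ TensorProduct.map f f) *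
      toConv (Algebra.linearMap k K ∘ₗ α.lin) * toConv (g ∘ₗ LinearMap.mul' k H))
    (v : H →ₗ[k] K ⊗[k] α.TwistedAlgebra)
    (hv_def : v = TensorProduct.map f α.u.toLinearMap ∘ₗ comul) (x y : H) :
    v x * v y =
      ∑ i ∈ (ℛ k x).index, ∑ j ∈ (ℛ k y).index,
        σ ((ℛ k x).left i ⊗ₜ (ℛ k y).left j) • v ((ℛ k x).right i * (ℛ k y).right j) := by
  let i₁ : K →ₐ[k] K ⊗[k] α.TwistedAlgebra := Algebra.TensorProduct.includeLeft
  let i₂ : α.TwistedAlgebra →ₐ[k] K ⊗[k] α.TwistedAlgebra :=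
    Algebra.TensorProduct.includeRight
  let m : H ⊗[k] H →ₗc[k] H := Bialgebra.mulCoalgHom k H
  have hv : toConv (v) = toConv (i₁.toLinearMap ∘ₗ f) *
      toConv (i₂.toLinearMap ∘ₗ α.u.toLinearMap) := by
    ext x
    change v x = (toConv (i₁.toLinearMap ∘ₗ f) *
      toConv (i₂.toLinearMap ∘ₗ α.u.toLinearMap)) x
    rw [(ℛ k x).convMul_apply, hv_def, LinearMap.comp_apply, ← (ℛ k x).eq]
    simp [i₁, i₂]
  have hvm : toConv (v ∘ₗ m.toLinearMap) =
      toConv (i₁.toLinearMap ∘ₗ f ∘ₗ m.toLinearMap) *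
      toConv (i₂.toLinearMap ∘ₗ α.u.toLinearMap ∘ₗ m.toLinearMap) := by
    have h := LinearMap.convMul_comp_coalgHom_distrib (toConv (i₁.toLinearMap ∘ₗ f))
      (toConv (i₂.toLinearMap ∘ₗ α.u.toLinearMap)) m
    rw [← hv] at h
    exact congrArg toConv h
  have hσ₁ : toConv (i₁.toLinearMap ∘ₗ σ) =
      toConv (i₁.toLinearMap ∘ₗ LinearMap.mul' k K ∘ₗ TensorProduct.map f f) *
      toConv (i₂.toLinearMap ∘ₗ Algebra.linearMap k α.TwistedAlgebra ∘ₗ α.lin) *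
      toConv (i₁.toLinearMap ∘ₗ g ∘ₗ m.toLinearMap) := by
    have h := LinearMap.algHom_comp_convMul_distrib i₁
      (toConv (LinearMap.mul' k K ∘ₗ TensorProduct.map f f) *
        toConv (Algebra.linearMap k K ∘ₗ α.lin))
      (toConv (g ∘ₗ LinearMap.mul' k H))
    have h₂ := LinearMap.algHom_comp_convMul_distrib i₁
      (toConv (LinearMap.mul' k K ∘ₗ TensorProduct.map f f))
      (toConv (Algebra.linearMap k K ∘ₗ α.lin))
    -- The values of `α` are scalars, so they can be moved from the factor `K` to the factor `ᵅH`,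
    -- where they meet `u ∘ m`.
    have h' : i₁.toLinearMap ∘ₗ Algebra.linearMap k K ∘ₗ α.lin =
        i₂.toLinearMap ∘ₗ Algebra.linearMap k α.TwistedAlgebra ∘ₗ α.lin := by
      refine LinearMap.ext fun c => ?_
      simp only [LinearMap.comp_apply, Algebra.linearMap_apply, AlgHom.toLinearMap_apply,
        AlgHom.commutes]
    rw [ofConv_toConv, ofConv_toConv, h'] at h₂
    rw [h₂, ← hσ] at h
    exact congrArg toConv h
  have hcancel : toConv (i₁.toLinearMap ∘ₗ g ∘ₗ m.toLinearMap) *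
      toConv (i₁.toLinearMap ∘ₗ f ∘ₗ m.toLinearMap) = 1 := by
    have h1 := LinearMap.convMul_comp_coalgHom_distrib (toConv (g))
      (toConv (f)) m
    have h2 := LinearMap.algHom_comp_convMul_distrib i₁
      (toConv (g ∘ₗ m.toLinearMap)) (toConv (f ∘ₗ m.toLinearMap))
    rw [hgf] at h1
    rw [← h1] at h2
    apply ofConv_injective
    refine h2.symm.trans (LinearMap.ext fun c => ?_)
    change i₁ (algebraMap k _ (counit (m c))) = algebraMap k _ (counit c)
    rw [AlgHom.commutes, CoalgHomClass.counit_comp_apply]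
  have hu : toConv (i₂.toLinearMap ∘ₗ Algebra.linearMap k α.TwistedAlgebra ∘ₗ α.lin) *
      toConv (i₂.toLinearMap ∘ₗ α.u.toLinearMap ∘ₗ m.toLinearMap) =
      toConv (i₂.toLinearMap ∘ₗ α.u.toLinearMap ∘ₗ α.mulLin) := by
    have h := LinearMap.algHom_comp_convMul_distrib i₂
      (toConv (Algebra.linearMap k α.TwistedAlgebra ∘ₗ α.lin))
      (toConv (α.u.toLinearMap ∘ₗ LinearMap.mul' k H))
    rw [convMul_u_mul] at h
    exact (congrArg toConv h).symm
  have key : toConv (i₁.toLinearMap ∘ₗ σ) * toConv (v ∘ₗ m.toLinearMap) =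
      toConv (i₁.toLinearMap ∘ₗ LinearMap.mul' k K ∘ₗ TensorProduct.map f f) *
      toConv (i₂.toLinearMap ∘ₗ α.u.toLinearMap ∘ₗ α.mulLin) := by
    rw [hσ₁, hvm, mul_assoc, ← mul_assoc (toConv (i₁.toLinearMap ∘ₗ g ∘ₗ m.toLinearMap)),
      hcancel, one_mul, mul_assoc, hu]
  have hxy := congrArg (fun f => f (x ⊗ₜ[k] y)) key
  simp only [((ℛ k x).tmul (ℛ k y)).convMul_apply] at hxy
  simp only [Coalgebra.Repr.tmul_index, Finset.sum_product] at hxy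
  have hg : ∀ x, v x = ∑ i ∈ (ℛ k x).index,
      f ((ℛ k x).left i) ⊗ₜ α.u ((ℛ k x).right i) := by
    intro x
    rw [hv_def, LinearMap.comp_apply]
    conv_lhs => rw [← (ℛ k x).eq, map_sum]
    rfl
  have hL : ∀ (s : K) (w : K ⊗[k] α.TwistedAlgebra), i₁ s * w = s • w :=
    fun s w => (Algebra.smul_def s w).symm
  have hR : ∀ a b c d : H, (f a ⊗ₜ[k] α.u b) * (f c ⊗ₜ[k] α.u d) =
      i₁ (f a * f c) * i₂ (α.u b * α.u d) := by
    intro a b c d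
    rw [Algebra.TensorProduct.tmul_mul_tmul]
    simp only [i₁, i₂, Algebra.TensorProduct.includeLeft_apply,
      Algebra.TensorProduct.includeRight_apply, Algebra.TensorProduct.tmul_mul_tmul, mul_one,
      one_mul]
  calc v x * v y
      = ∑ i ∈ (ℛ k x).index, ∑ j ∈ (ℛ k y).index,
          (f ((ℛ k x).left i) ⊗ₜ[k] α.u ((ℛ k x).right i)) *
            (f ((ℛ k y).left j) ⊗ₜ[k] α.u ((ℛ k y).right j)) := by
        rw [hg x, hg y]
        exact Finset.sum_mul_sum _ _ _ _
    _ = _ := Finset.sum_congr rfl fun i _ => Finset.sum_congr rfl fun j _ => hR _ _ _ _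
    _ = _ := hxy.symm
    _ = _ := Finset.sum_congr rfl fun i _ => Finset.sum_congr rfl fun j _ => hL _ _

theorem TwoCocycle.genericElement_mul (x y : H) :
    α.genericElement x * α.genericElement y =
      ∑ i ∈ (ℛ k x).index, ∑ j ∈ (ℛ k y).index,
        α.sigma ((ℛ k x).left i ⊗ₜ (ℛ k y).left j) •
          α.genericElement ((ℛ k x).right i * (ℛ k y).right j) :=
  α.twisted_mul (genT k H) (genTInv k H) genTInv_mul_genT α.sigma rfl α.genericElement rfl x y

/-! ### The generic base algebra contains the center -/

theorem TwoCocycle.sigma_mem (w : H ⊗[k] H) : α.sigma w ∈ α.genericBase := by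
  induction w using TensorProduct.induction_on with
  | zero => rw [map_zero]; exact zero_mem _
  | add x y hx hy => rw [map_add]; exact add_mem hx hy
  | tmul x y => exact Algebra.subset_adjoin (Or.inl ⟨x, y, rfl⟩)

theorem TwoCocycle.lin_one : α.lin 1 = 1 := by
  simp [lin, Algebra.TensorProduct.one_def, α.form_one_left]

theorem TwoCocycle.inv_one : α.inv 1 = 1 := by
  have h : toConv α.lin * toConv α.inv = 1 := α.isUnit.mul_val_inv
  have h1 := convMul_apply_one (toConv α.lin) (toConv α.inv)
  rw [h] at h1
  simpa [lin_one] using h1.symm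

/-- As `1` is grouplike, evaluating a convolution at `1` is multiplicative: `σ(1, 1) = t_1 t_1 α(1,
1) t⁻¹_1 = t_1`. -/
theorem TwoCocycle.genT_one_mem : genT k H 1 ∈ α.genericBase := by
  have h : α.sigma 1 = genT k H 1 := by
    have h1 := convMul_apply_one (toConv (outer k H (genT k H) (genT k H)) *
      toConv (Algebra.linearMap k (FracS k H) ∘ₗ α.lin))
      (toConv (genTInv k H ∘ₗ LinearMap.mul' k H))
    refine h1.trans ?_
    rw [convMul_apply_one]
    simp only [LinearMap.comp_apply, lin_one, Algebra.linearMap_apply, map_one,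
      mul_one]
    simp [outer, Algebra.TensorProduct.one_def, mul_assoc, genT_one_mul_genTInv_one]
  rw [← h]
  exact α.sigma_mem 1

theorem TwoCocycle.genTInv_one_mem : genTInv k H 1 ∈ α.genericBase := by
  have h : α.sigmaInv 1 = genTInv k H 1 := by
    have h1 := convMul_apply_one (toConv (genT k H ∘ₗ LinearMap.mul' k H) *
      toConv (Algebra.linearMap k (FracS k H) ∘ₗ α.inv))
      (toConv (outer k H (genTInv k H) (genTInv k H)))
    refine h1.trans ?_
    rw [convMul_apply_one]
    simp only [LinearMap.comp_apply, inv_one, Algebra.linearMap_apply, map_one,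
      mul_one]
    simp [outer, Algebra.TensorProduct.one_def, ← mul_assoc, genT_one_mul_genTInv_one]
  rw [← h]
  exact Algebra.subset_adjoin (Or.inr ⟨1, 1, rfl⟩)

theorem TwoCocycle.genericElement_one : α.genericElement 1 = genT k H 1 ⊗ₜ 1 := by
  simp [genericElement, Algebra.TensorProduct.one_def, one_eq_u]

theorem TwoCocycle.one_mem_span :
    (1 : FracS k H ⊗[k] α.TwistedAlgebra) ∈
      Submodule.span α.genericBase (Set.range α.genericElement) := by
  have h : (1 : FracS k H ⊗[k] α.TwistedAlgebra) =
      (⟨genTInv k H 1, α.genTInv_one_mem⟩ : α.genericBase) • α.genericElement 1 := by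
    rw [Subalgebra.smul_def, genericElement_one, TensorProduct.smul_tmul', smul_eq_mul, mul_comm,
      genT_one_mul_genTInv_one, Algebra.TensorProduct.one_def]
  rw [h]
  exact Submodule.smul_mem _ _ (Submodule.subset_span ⟨1, rfl⟩)

/-- The structure constants of the products `v_x v_y` are values of `σ`, so the span is closed under
multiplication. -/
theorem TwoCocycle.mul_mem_span {y z : FracS k H ⊗[k] α.TwistedAlgebra}
    (hy : y ∈ Submodule.span α.genericBase (Set.range α.genericElement))
    (hz : z ∈ Submodule.span α.genericBase (Set.range α.genericElement)) :
    y * z ∈ Submodule.span α.genericBase (Set.range α.genericElement) := by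
  have h := Submodule.mul_mem_mul hy hz
  rw [Submodule.span_mul_span] at h
  refine Submodule.span_le.mpr ?_ h
  rintro _ ⟨_, ⟨a, rfl⟩, _, ⟨b, rfl⟩, rfl⟩
  change α.genericElement a * α.genericElement b ∈ _
  rw [genericElement_mul]
  exact sum_mem fun i _ => sum_mem fun j _ => Submodule.smul_mem _
    (⟨_, α.sigma_mem _⟩ : α.genericBase) (Submodule.subset_span ⟨_, rfl⟩)

theorem TwoCocycle.inclFrac_universalMap_mem_span (P : TensorAlgebra k H) :
    α.inclFrac (α.universalMap P) ∈
      Submodule.span α.genericBase (Set.range α.genericElement) := by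
  induction P using TensorAlgebra.induction with
  | algebraMap r =>
    have h : algebraMap k (FracS k H ⊗[k] α.TwistedAlgebra) r =
        algebraMap k α.genericBase r • (1 : FracS k H ⊗[k] α.TwistedAlgebra) := by
      rw [Subalgebra.smul_def, Algebra.TensorProduct.one_def, TensorProduct.smul_tmul',
        smul_eq_mul, mul_one]
      rfl
    rw [AlgHom.commutes, AlgHom.commutes, h]
    exact Submodule.smul_mem _ _ α.one_mem_span
  | ι x =>
    rw [inclFrac_universalMap_ι]
    exact Submodule.subset_span ⟨x, rfl⟩
  | mul a b ha hb =>
    rw [map_mul, map_mul]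
    exact α.mul_mem_span ha hb
  | add a b ha hb =>
    rw [map_add, map_add]
    exact add_mem ha hb

/-- The `Frac S(t_H)`-linear map `a ⊗ u_x ↦ a t⁻¹_x`. -/
def TwoCocycle.contract : FracS k H ⊗[k] α.TwistedAlgebra →ₗ[FracS k H] FracS k H :=
  extend (genTInv k H ∘ₗ α.u.symm.toLinearMap)

theorem TwoCocycle.contract_genericElement (x : H) :
    α.contract (α.genericElement x) = algebraMap k (FracS k H) (counit (R := k) x) := by
  have h := congrArg (fun f => f x) (genT_mul_genTInv (k := k) (H := H))
  simp only [(ℛ k x).convMul_apply, LinearMap.convOne_apply] at h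
  rw [← h, genericElement, LinearMap.comp_apply]
  conv_lhs => rw [← (ℛ k x).eq]
  simp [contract]

theorem TwoCocycle.contract_mem {y : FracS k H ⊗[k] α.TwistedAlgebra}
    (hy : y ∈ Submodule.span α.genericBase (Set.range α.genericElement)) :
    α.contract y ∈ α.genericBase := by
  induction hy using Submodule.span_induction with
  | mem _ h =>
    obtain ⟨x, rfl⟩ := h
    rw [contract_genericElement]
    exact α.genericBase.algebraMap_mem _
  | zero => rw [map_zero]; exact zero_mem _
  | add _ _ _ _ ha hb => rw [map_add]; exact add_mem ha hb
  | smul b _ _ ha =>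
    rw [Subalgebra.smul_def, map_smul]
    exact mul_mem b.2 ha

/-- Contraction gives `b t⁻¹_1`, and the factor `t⁻¹_1` is removed by multiplying by `t_1`, which
lies in the base algebra. -/
theorem TwoCocycle.mem_genericBase_of_tmul_one {b : FracS k H}
    (hb : b ⊗ₜ[k] (1 : α.TwistedAlgebra) ∈
      Submodule.span α.genericBase (Set.range α.genericElement)) : b ∈ α.genericBase := by
  have h := mul_mem (α.contract_mem hb) α.genT_one_mem
  have h1 : α.contract (b ⊗ₜ[k] (1 : α.TwistedAlgebra)) = b * genTInv k H 1 := by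
    simp [contract, one_eq_u]
  rwa [h1, mul_assoc, mul_comm (genTInv k H 1), genT_one_mul_genTInv_one, mul_one] at h

theorem TwoCocycle.exists_mem_genericBase [Infinite k] (hα : α.IsNondegenerate)
    {z : UniversalAlgebra k H α.TwistedAlgebra}
    (hz : z ∈ Subalgebra.center k (UniversalAlgebra k H α.TwistedAlgebra)) :
    ∃ b ∈ α.genericBase, α.inclFrac (α.universalMapBar z) = b ⊗ₜ[k] α.u 1 := by
  obtain ⟨b, hb⟩ := α.exists_eq_tmul_one hα (α.inclFrac (α.universalMapBar z)) fun x => by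
    rw [← inclFrac_universalMap_ι, ← universalMapBar_mk]
    have h : Commute z (Ideal.Quotient.mk _ (TensorAlgebra.ι k x)) :=
      ((Subalgebra.mem_center_iff.mp hz) _).symm
    exact (h.map α.universalMapBar).map α.inclFrac
  refine ⟨b, α.mem_genericBase_of_tmul_one ?_, hb⟩
  rw [← hb]
  obtain ⟨P, rfl⟩ := Ideal.Quotient.mk_surjective z
  exact α.inclFrac_universalMap_mem_span P

/-- The inclusion of the generic base algebra in `Frac S(t_H) ⊗ ᵅH`, `b ↦ b ⊗ u_1`. -/
def TwoCocycle.baseIncl : α.genericBase →ₐ[k] FracS k H ⊗[k] α.TwistedAlgebra :=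
  (Algebra.TensorProduct.includeLeft : FracS k H →ₐ[k] _).comp α.genericBase.val

theorem TwoCocycle.baseIncl_injective : Function.Injective α.baseIncl := by
  have : Nontrivial H := (Bialgebra.counitAlgHom k H).toRingHom.domain_nontrivial
  have : Nontrivial α.TwistedAlgebra := α.u.injective.nontrivial
  exact (Algebra.TensorProduct.includeLeft_injective (S := k)
    (algebraMap k α.TwistedAlgebra).injective).comp Subtype.val_injective

/-- The embedding of the center of the universal comodule algebra in the generic base algebra. -/
def TwoCocycle.centerEmb [Infinite k] (hα : α.IsNondegenerate) :
    Subalgebra.center k (UniversalAlgebra k H α.TwistedAlgebra) →ₐ[k] α.genericBase :=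
  (AlgEquiv.ofInjective α.baseIncl α.baseIncl_injective).symm.toAlgHom.comp
    (((α.inclFrac.comp α.universalMapBar).comp (Subalgebra.val _)).codRestrict
      α.baseIncl.range fun z => by
        obtain ⟨b, hb, h⟩ := α.exists_mem_genericBase hα z.2
        exact ⟨⟨b, hb⟩, h.symm⟩)

theorem TwoCocycle.baseIncl_centerEmb [Infinite k] (hα : α.IsNondegenerate)
    (z : Subalgebra.center k (UniversalAlgebra k H α.TwistedAlgebra)) :
    α.inclFrac (α.universalMapBar z) = α.baseIncl (α.centerEmb hα z) := by
  have h := (AlgEquiv.ofInjective α.baseIncl α.baseIncl_injective).apply_symm_apply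
    ((((α.inclFrac.comp α.universalMapBar).comp (Subalgebra.val _)).codRestrict
      α.baseIncl.range fun z => by
        obtain ⟨b, hb, h⟩ := α.exists_mem_genericBase hα z.2
        exact ⟨⟨b, hb⟩, h.symm⟩) z)
  exact (congrArg Subtype.val h).symm

theorem TwoCocycle.centerEmb_injective [Infinite k] (hα : α.IsNondegenerate) :
    Function.Injective (α.centerEmb hα) := by
  intro x y h
  apply Subtype.ext
  apply α.universalMapBar_injective
  apply α.inclFrac_injective
  rw [baseIncl_centerEmb α hα x, baseIncl_centerEmb α hα y, h]

end Center

end GenericHopf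

end

theorem mainTheorem9 {k : Type*} [Field k] [Infinite k] {H : Type*} [Ring H] [HopfAlgebra k H]
    (α : GenericHopf.TwoCocycle k H) (hα : α.IsNondegenerate) :
    IsUnit (WithConv.toConv (GenericHopf.genT k H)) ∧
    ∃ μbar : GenericHopf.UniversalAlgebra k H α.TwistedAlgebra →ₐ[k]
        SymmetricAlgebra k H ⊗[k] α.TwistedAlgebra,
      (∀ P : TensorAlgebra k H,
        μbar (Ideal.Quotient.mk (GenericHopf.identityIdeal k H α.TwistedAlgebra) P) =
          α.universalMap P) ∧
      Function.Injective μbar ∧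
      (∀ z ∈ Subalgebra.center k (GenericHopf.UniversalAlgebra k H α.TwistedAlgebra),
        ∃ b ∈ α.genericBase, α.inclFrac (μbar z) = b ⊗ₜ[k] α.u 1) ∧
      (∃ emb : Subalgebra.center k (GenericHopf.UniversalAlgebra k H α.TwistedAlgebra) →ₐ[k]
          α.genericBase,
        Function.Injective emb ∧
        ∀ z : Subalgebra.center k (GenericHopf.UniversalAlgebra k H α.TwistedAlgebra),
          α.inclFrac (μbar z) = (emb z : GenericHopf.FracS k H) ⊗ₜ[k] α.u 1) ∧
      IsDomain (Subalgebra.center k (GenericHopf.UniversalAlgebra k H α.TwistedAlgebra)) ∧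
      ringKrullDim (Subalgebra.center k (GenericHopf.UniversalAlgebra k H α.TwistedAlgebra)) ≤
        (Cardinal.toENat (Module.rank k H) : WithBot ℕ∞) := by
  -- The embedding into the field `Frac S(t_H)` gives both the domain property and the dimension
  -- bound.
  have hinj : Function.Injective (α.genericBase.val.comp (α.centerEmb hα)) :=
    Subtype.val_injective.comp (α.centerEmb_injective hα)
  exact ⟨GenericHopf.isUnit_genT, α.universalMapBar, α.universalMapBar_mk,
    α.universalMapBar_injective, fun z hz => α.exists_mem_genericBase hα hz,
    ⟨α.centerEmb hα, α.centerEmb_injective hα, α.baseIncl_centerEmb hα⟩,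
    hinj.isDomain (α.genericBase.val.comp (α.centerEmb hα)).toRingHom,
    ringKrullDim_le_of_injective_fractionRing_symmetricAlgebra
      (V := H) (α.genericBase.val.comp (α.centerEmb hα)) hinj⟩
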